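/- **Setting.** Let $\mathbb X\subset\mathbb R^d$ be compact, $A\in\mathbb R^{d\times d}$, $b\in\mathbb R^d$, and consider $\dot x=Ax+b(u+f(x))$ with unknown $f:\mathbb X\to\mathbb R$. The reference satisfies $\dot x_{\rm ref}=Ax_{\rm ref}+b\,r_{\rm ref}$ and $x_{\rm ref}(t)\in\mathbb X$ for $t\ge 0$. The control law is $u=-\theta^{T}(x-x_{\rm ref})+r_{\rm ref}-\mu(x)$, and $A_\theta=A-b\theta^{T}$. For all $\theta$ in a set $\Theta$ of admissible gains, $A_\theta$ has $d$ distinct eigenvalues and $\lambda_{\max}(A_\theta)\le-\alpha(\|\theta\|)$, where $\lambda_{\max}$ is the maximal real part of the eigenvalues and $\alpha:[0,\infty)\to[0,\infty)$ is monotonically increasing with $\alpha(0)=0$, $\alpha(s)\to\infty$ as $s\to\infty$. For an eigendecomposition $A_\theta=U\Lambda U^{-1}$ put $\zeta=\|U\|\,\|U^{-1}b\|$. The function $f$ is a sample of a zero-mean Gaussian process on $\mathbb X$ with stationary kernel $k(x,x')=k(x-x')$; $k$ is differentiable and $L_k$-Lipschitz on $\{x-x':x,x'\in\mathbb X\}$.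 Given inputs $x^{(1)},\dots,x^{(N)}\in\mathbb X$ and targets $y^{(n)}=f(x^{(n)})+\epsilon^{(n)}$ with i.i.d. $\epsilon^{(n)}\sim\mathcal N(0,\sigma_{\rm on}^2)$, $\sigma_{\rm on}>0$, independent of $f$, the posterior mean and variance are $$\mu(x)=\mathbf k(x)^T(K+\sigma_{\rm on}^2I)^{-1}y,\qquad \sigma^2(x)=k(x,x)-\mathbf k(x)^T(K+\sigma_{\rm on}^2I)^{-1}\mathbf k(x),$$ with $K_{ij}=k(x^{(i)},x^{(j)})$, $\mathbf k_i(x)=k(x,x^{(i)})$. The data density is $$\rho(x)=\sup\{\rho'>0:\ |\mathbb K_{\rho'}(x)|\ge\rho'\sigma_{\rm on}^2k(x,x)\},\quad \mathbb K_{\rho'}(x)=\{n: k^2(x,x)\le k^2(x^{(n)},x^{(n)})\le \tfrac1{\rho'}+k^2(x^{(n)},x)\},$$ and $\underline\rho=\inf_{t\ge0}\rho(x_{\rm ref}(t))$. Let $\delta\in(0,1)$, let $L_f$, $L_\mu\ge 0$ be Lipschitz constants for $f$ and $\mu$, let $$L_\sigma=\sup_{x,x'\in\mathbb X,\ k(x-x')\neq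 k(0)}\frac{\|\nabla k(x-x')\|}{\sqrt{2k(0)-2k(x-x')}}$$ be finite, and let $M(\tau,\mathbb X)$ be the $\tau$-covering number of $\mathbb X$. For $\tau>0$ put $$\beta_{\mathbb X}(\tau)=2\log\frac{M(\tau,\mathbb X)}{\delta},\quad \gamma(\tau)=(L_\mu+L_f)\tau+\sqrt{\beta_{\mathbb X}(\tau)}\,L_\sigma\tau,\quad \eta(x)=\sqrt{\beta_{\mathbb X}(\tau)}\,\sigma(x)+\gamma(\tau),$$ $$\bar\upsilon=-\frac{\zeta}{\lambda_{\max}(A_\theta)+L_\sigma\zeta\sqrt{\beta_{\mathbb X}(\tau)}}\ \sup_{t\ge0}\eta(x_{\rm ref}(t)).$$ **Theorem.** Fix $\kappa\in\mathbb R$. Let the training inputs (and their number), $L_\mu$, $\tau>0$, $\theta\in\Theta$ and $U$ vary subject to $$\beta_{\mathbb X}(\tau)\ge\frac{\gamma^2(\tau)\,\underline\rho\,k(0)}{2},\qquad L_\sigma\zeta\sqrt{\beta_{\mathbb X}(\tau)}\le\alpha(\|\theta\|),\qquad -\frac{2\zeta\sqrt{\beta_{\mathbb X}(\tau)}}{\lambda_{\max}(A_\theta)+L_\sigma\zeta\sqrt{\beta_{\mathbb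 X}(\tau)}}=\kappa ,$$ the last denominator being non-zero. Then $$\bar\upsilon\in\mathcal O\!\left(\frac1{\sqrt{\underline\rho}}\right)\qquad(\underline\rho\to\infty),$$ uniformly over all such choices. Here $\bar\upsilon$ is a bound for the tracking error: if $\mathbb X$ is convex, then for every such choice there is an event of probability at least $1-\delta$ on which, whenever $f$ is $L_f$-Lipschitz and $\mu$ is $L_\mu$-Lipschitz on $\mathbb X$, every closed-loop trajectory $x:[0,\infty)\to\mathbb X$ with $x(0)=x_{\rm ref}(0)$ satisfies $\sup_{t\ge0}\|x(t)-x_{\rm ref}(t)\|\le\bar\upsilon$. -/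

import Mathlib

open MeasureTheory ProbabilityTheory Filter Set
open scoped NNReal ENNReal Topology

noncomputable section

namespace GPTracking

/-- The state space `ℝ^d` with the Euclidean norm. -/
abbrev State (d : ℕ) : Type := EuclideanSpace ℝ (Fin d)

/-! ### Gaussian process regression -/

section Regression

variable {E : Type*}

/-- A (covariance) kernel: a symmetric, positive semidefinite function. -/
def IsKernel (k : E → E → ℝ) : Prop :=
  (∀ x x', k x x' = k x' x) ∧
    ∀ (n : ℕ) (z : Fin n → E) (c : Fin n → ℝ), 0 ≤ ∑ i, ∑ j, c i * c j * k (z i) (z j)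

/-- The stationary kernel `k(x, x') = k(x - x')` induced by a function of one variable. -/
def stationary [Sub E] (k : E → ℝ) : E → E → ℝ := fun x x' => k (x - x')

/-- The kernel matrix `K`, `K i j = k(x⁽ⁱ⁾, x⁽ʲ⁾)`. -/
def kernelMatrix (k : E → E → ℝ) {N : ℕ} (X : Fin N → E) : Matrix (Fin N) (Fin N) ℝ :=
  Matrix.of fun i j => k (X i) (X j)

/-- The kernel vector `k(x)`, `k i (x) = k(x, x⁽ⁱ⁾)`. -/
def kernelVector (k : E → E → ℝ) {N : ℕ} (X : Fin N → E) (x : E) : Fin N → ℝ :=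
  fun i => k x (X i)

/-- The regularised kernel matrix `K + σ_on² I`. -/
def noisyKernelMatrix (k : E → E → ℝ) (σon : ℝ) {N : ℕ} (X : Fin N → E) :
    Matrix (Fin N) (Fin N) ℝ :=
  kernelMatrix k X + (σon ^ 2) • (1 : Matrix (Fin N) (Fin N) ℝ)

/-- The posterior mean `μ(x) = k(x)ᵀ (K + σ_on² I)⁻¹ y`. -/
def postMean (k : E → E → ℝ) (σon : ℝ) {N : ℕ} (X : Fin N → E) (y : Fin N → ℝ) (x : E) : ℝ :=
  kernelVector k X x ⬝ᵥ ((noisyKernelMatrix k σon X)⁻¹.mulVec y)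

/-- The posterior variance `σ²(x) = k(x, x) - k(x)ᵀ (K + σ_on² I)⁻¹ k(x)`. -/
def postVar (k : E → E → ℝ) (σon : ℝ) {N : ℕ} (X : Fin N → E) (x : E) : ℝ :=
  k x x - kernelVector k X x ⬝ᵥ ((noisyKernelMatrix k σon X)⁻¹.mulVec (kernelVector k X x))

/-- The posterior standard deviation `σ(x)`. -/
def postStd (k : E → E → ℝ) (σon : ℝ) {N : ℕ} (X : Fin N → E) (x : E) : ℝ :=
  √(postVar k σon X x)

/-- The (indices of the) training inputs in the kernel neighbourhood
`{x' ∈ 𝔻ˣ : k²(x, x) ≤ k²(x', x') ≤ 1/ρ' + k²(x', x)}` of `x`. -/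
def kernelNbhd (k : E → E → ℝ) {N : ℕ} (X : Fin N → E) (ρ' : ℝ) (x : E) : Set (Fin N) :=
  {i | k x x ^ 2 ≤ k (X i) (X i) ^ 2 ∧ k (X i) (X i) ^ 2 ≤ 1 / ρ' + k (X i) x ^ 2}

/-- The kernel-based data density `ρ(x)`: the largest `ρ' > 0` for which the kernel neighbourhood
of `x` contains at least `ρ' σ_on² k(x, x)` training samples. -/
def dataDensity (k : E → E → ℝ) (σon : ℝ) {N : ℕ} (X : Fin N → E) (x : E) : ℝ :=
  sSup {ρ' : ℝ | 0 < ρ' ∧ ρ' * σon ^ 2 * k x x ≤ ((kernelNbhd k X ρ' x).ncard : ℝ)}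

/-- The minimum data density `inf_{t ≥ 0} ρ(x_ref(t))` along a reference trajectory. -/
def minDataDensity (k : E → E → ℝ) (σon : ℝ) {N : ℕ} (X : Fin N → E) (xref : ℝ → E) : ℝ :=
  sInf ((fun t => dataDensity k σon X (xref t)) '' Ici 0)

/-- The sampling model: on `𝕏`, the function `f` is a sample of a zero-mean Gaussian process with
covariance `k`, and the noise variables `ε j` are i.i.d. `𝒩(0, σ_on²)`, independent of `f`. -/
structure IsSamplingModel {Ω : Type*} [MeasurableSpace Ω] (Pr : Measure Ω) (k : E → E → ℝ)
    (σon : ℝ) (𝕏 : Set E) (f : E → Ω → ℝ) {N : ℕ} (ε : Fin N → Ω → ℝ) : Prop where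
  gaussian : IsGaussianProcess (fun (x : 𝕏) ω => f x ω) Pr
  mean_zero : ∀ x ∈ 𝕏, ∫ ω, f x ω ∂Pr = 0
  cov_eq : ∀ x ∈ 𝕏, ∀ x' ∈ 𝕏, covariance (f x) (f x') Pr = k x x'
  noise_law : ∀ j, HasLaw (ε j) (gaussianReal 0 (Real.toNNReal (σon ^ 2))) Pr
  noise_indep : iIndepFun ε Pr
  noise_indep_f : IndepFun (fun ω (x : 𝕏) => f x ω) (fun ω j => ε j ω) Pr

end Regression

/-! ### The uniform error bound -/

section ErrorBound

variable {d : ℕ}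

/-- `β_𝕏(τ) = 2 log (M(τ, 𝕏) / δ)`, where `M(τ, 𝕏)` is the least number of points whose closed
`τ`-balls cover `𝕏`. -/
def beta (𝕏 : Set (State d)) (δ τ : ℝ) : ℝ :=
  2 * Real.log (((Metric.externalCoveringNumber τ.toNNReal 𝕏).toNat : ℝ) / δ)

/-- The values `√(1 / (2k(0) - 2k(r))) ‖∇k(r)‖`, `r = x - x'` with `x, x' ∈ 𝕏`, where
`k(r) ≠ k(0)`: these are the norms of the gradient of `r ↦ √(2k(0) - 2k(r))`. -/
def kernelSlopes (k : State d → ℝ) (𝕏 : Set (State d)) : Set ℝ :=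
  {s | ∃ x ∈ 𝕏, ∃ x' ∈ 𝕏, k (x - x') ≠ k 0 ∧
    s = √(1 / (2 * k 0 - 2 * k (x - x'))) * ‖gradient k (x - x')‖}

/-- `L_σ`, the supremum of the values above. -/
def lipStd (k : State d → ℝ) (𝕏 : Set (State d)) : ℝ := sSup (kernelSlopes k 𝕏)

/-- `γ(τ) = (L_μ + L_f) τ + √β_𝕏(τ) ω_σ(τ)` with `ω_σ(τ) = L_σ τ`. -/
def gam (k : State d → ℝ) (𝕏 : Set (State d)) (δ : ℝ) (Lf Lμ : ℝ≥0) (τ : ℝ) : ℝ :=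
  (Lμ + Lf) * τ + √(beta 𝕏 δ τ) * (lipStd k 𝕏 * τ)

/-- The learning error bound `η(x) = √β_𝕏(τ) σ(x) + γ(τ)`. -/
def eta (k : State d → ℝ) (σon : ℝ) (𝕏 : Set (State d)) (δ : ℝ) (Lf Lμ : ℝ≥0) (τ : ℝ)
    {N : ℕ} (X : Fin N → State d) (x : State d) : ℝ :=
  √(beta 𝕏 δ τ) * postStd (stationary k) σon X x + gam k 𝕏 δ Lf Lμ τ

end ErrorBound

/-! ### The control loop -/

section Control

variable {d : ℕ}

/-- Class `𝒦_∞` functions on the non-negative reals. -/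
def IsClassKInfty (α : ℝ → ℝ) : Prop :=
  MonotoneOn α (Ici 0) ∧ α 0 = 0 ∧ Tendsto α atTop atTop

/-- `A_θ = A - b θᵀ`. -/
def closedLoopMatrix (A : Matrix (Fin d) (Fin d) ℝ) (b θ : State d) : Matrix (Fin d) (Fin d) ℝ :=
  A - Matrix.vecMulVec b.ofLp θ.ofLp

/-- A real matrix regarded as a complex one. -/
def complexify (M : Matrix (Fin d) (Fin d) ℝ) : Matrix (Fin d) (Fin d) ℂ :=
  M.map Complex.ofReal

/-- `λ_max(M)`, the maximum real part of the complex eigenvalues of `M`. -/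
def lamMax (M : Matrix (Fin d) (Fin d) ℝ) : ℝ :=
  sSup (Complex.re '' spectrum ℂ (complexify M))

/-- The stability assumption: for all admissible gains `θ ∈ Θ`, the matrix `A_θ` has `d` distinct
eigenvalues, and `λ_max(A_θ) ≤ -α(‖θ‖)` with `α` of class `𝒦_∞` (so that no eigenvalue has positive
real part). -/
def StabilizedBy (A : Matrix (Fin d) (Fin d) ℝ) (b : State d) (Θ : Set (State d)) (α : ℝ → ℝ) :
    Prop :=
  IsClassKInfty α ∧ ∀ θ ∈ Θ,
    (spectrum ℂ (complexify (closedLoopMatrix A b θ))).ncard = d ∧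
      lamMax (closedLoopMatrix A b θ) ≤ -α ‖θ‖

/-- `U` gives an eigendecomposition `M = U Λ U⁻¹` with `Λ` diagonal. -/
def IsEigendecomposition (M : Matrix (Fin d) (Fin d) ℝ) (U : Matrix (Fin d) (Fin d) ℂ) : Prop :=
  IsUnit U ∧ ∃ Λ : Fin d → ℂ, complexify M = U * Matrix.diagonal Λ * U⁻¹

/-- `ζ = ‖U‖ ‖U⁻¹ b‖`, with the spectral norm of `U` and the Euclidean norm of `U⁻¹ b`. -/
def zeta (b : State d) (U : Matrix (Fin d) (Fin d) ℂ) : ℝ :=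
  ‖Matrix.toEuclideanCLM (n := Fin d) (𝕜 := ℂ) U‖ *
    ‖WithLp.toLp 2 (U⁻¹.mulVec fun i => ((b i : ℝ) : ℂ))‖

/-- `x_ref` solves `ẋ_ref = A x_ref + b r_ref` on `[0, ∞)` and stays in `𝕏`. -/
def IsReference (A : Matrix (Fin d) (Fin d) ℝ) (b : State d) (𝕏 : Set (State d))
    (xref : ℝ → State d) (rref : ℝ → ℝ) : Prop :=
  ∀ t, 0 ≤ t → xref t ∈ 𝕏 ∧
    HasDerivWithinAt xref (Matrix.toEuclideanLin A (xref t) + rref t • b) (Ici 0) t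

/-- The control law `u = -θᵀ (x - x_ref) + r_ref - f̂(x)`. -/
def control (θ : State d) (fhat : State d → ℝ) (xref : ℝ → State d) (rref : ℝ → ℝ)
    (x : State d) (t : ℝ) : ℝ :=
  -(inner ℝ θ (x - xref t)) + rref t - fhat x

/-- `x` solves `ẋ = A x + b (u + f(x))` under the control law on `[0, ∞)` and stays in `𝕏`. -/
def IsClosedLoop (A : Matrix (Fin d) (Fin d) ℝ) (b : State d) (𝕏 : Set (State d))
    (f fhat : State d → ℝ) (θ : State d) (xref : ℝ → State d) (rref : ℝ → ℝ)
    (x : ℝ → State d) : Prop :=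
  ∀ t, 0 ≤ t → x t ∈ 𝕏 ∧
    HasDerivWithinAt x
      (Matrix.toEuclideanLin A (x t) + (control θ fhat xref rref (x t) t + f (x t)) • b) (Ici 0) t

/-- Everything that may vary while the density of the data grows: the number `N` of training
samples, the training inputs `X`, the Lipschitz constant `Lμ` of the posterior mean, the virtual
grid constant `τ`, the control gain `θ` and the matrix `U` of eigenvectors of `A_θ`. -/
structure Design (d : ℕ) where
  N : ℕ
  X : Fin N → State d
  Lμ : ℝ≥0
  τ : ℝ
  θ : State d
  U : Matrix (Fin d) (Fin d) ℂ

/-- The fixed data: system `(A, b)`, kernel `k`, noise level `σon`, domain `𝕏`, confidence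
parameter `δ`, Lipschitz constant `Lf` and reference `xref`. -/
structure Problem (d : ℕ) where
  A : Matrix (Fin d) (Fin d) ℝ
  b : State d
  k : State d → ℝ
  σon : ℝ
  𝕏 : Set (State d)
  δ : ℝ
  Lf : ℝ≥0
  xref : ℝ → State d

namespace Problem

variable (P : Problem d) (D : Design d)

/-- `ρ̲ = inf_{t ≥ 0} ρ(x_ref(t))`. -/
def rhoMin : ℝ := minDataDensity (stationary P.k) P.σon D.X P.xref

/-- `λ_max(A_θ) + L_σ ζ √β_𝕏(τ)`. -/
def rate : ℝ :=
  lamMax (closedLoopMatrix P.A P.b D.θ) +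
    lipStd P.k P.𝕏 * zeta P.b D.U * √(beta P.𝕏 P.δ D.τ)

/-- The maximum tracking error bound
`ῡ = -ζ / (λ_max(A_θ) + L_σ ζ √β_𝕏(τ)) * sup_{t ≥ 0} η(x_ref(t))`. -/
def upsilonBar : ℝ :=
  -(zeta P.b D.U / P.rate D) *
    sSup ((fun t => eta P.k P.σon P.𝕏 P.δ P.Lf D.Lμ D.τ D.X (P.xref t)) '' Ici 0)

/-- The conditions on training inputs, `τ` and `θ`. The gain condition is written as
`L_σ ζ √β_𝕏(τ) ≤ α(‖θ‖)`, i.e. `‖θ‖ ≥ α⁻¹(L_σ ζ √β_𝕏(τ))`; the condition `rate ≠ 0` says that `κ`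
is well-defined. -/
structure Admissible (Θ : Set (State d)) (α : ℝ → ℝ) (κ : ℝ) : Prop where
  inputs_mem : ∀ i, D.X i ∈ P.𝕏
  tau_pos : 0 < D.τ
  gain_mem : D.θ ∈ Θ
  eigen : IsEigendecomposition (closedLoopMatrix P.A P.b D.θ) D.U
  tau_cond : gam P.k P.𝕏 P.δ P.Lf D.Lμ D.τ ^ 2 * P.rhoMin D * P.k 0 / 2 ≤ beta P.𝕏 P.δ D.τ
  gain_cond : lipStd P.k P.𝕏 * zeta P.b D.U * √(beta P.𝕏 P.δ D.τ) ≤ α ‖D.θ‖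
  rate_ne_zero : P.rate D ≠ 0
  kappa_eq : κ = -(2 * zeta P.b D.U * √(beta P.𝕏 P.δ D.τ)) / P.rate D

end Problem

end Control

end GPTracking

end

open GPTracking

open GPTracking

/-! Asymptotics. The posterior variance is the least mean squared error among linear predictors from
the data, so any test weights bound it. Weights supported on the kernel neighbourhood give `σ² ≤ 2 /
(ρ k(0))` (`IsKernel.dataDensity_mul_le`). The condition on `τ` says that `γ ≤ √β √(2 / (k(0) ρ̲))`,
the same bound as for `√β σ`. Hence `sup η ≤ 2 √β √(2 / (k(0) ρ̲))` along the reference. As `κ`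
fixes `2 ζ √β / rate` up to sign, the factor `√β` cancels and `|ῡ| ≤ |κ| √(2 / (k(0) ρ̲))`, with no
other dependence on the design.

Tracking. The residual of the posterior mean is a centred Gaussian of variance `σ²`. A sharp tail
bound and a union bound over a `τ`-cover with `M` points fail with probability at most `M exp(-β/2)
= δ`. Lipschitz continuity of `f`, `μ` and `σ` extends the estimate from the cover to `|f - μ| ≤ η`
on `𝕏`. The error solves `ė = A_θ e + (f - μ) b`; diagonalisation gives `‖e‖ ≤ ζ sup |f - μ| /
-λ_max`, while `|f - μ| ≤ sup η(x_ref) + √β L_σ ‖e‖` along the trajectory. Because `rate < 0`, the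
last term can be absorbed, which leaves `ῡ`. -/

namespace GPTracking

/-! ### Posterior variance and data density -/

section Regression

variable {E : Type*} {N : ℕ}

/-- The mean squared error of the linear predictor with weights `w`, in terms of the kernel. -/
noncomputable def linearError (k : E → E → ℝ) (σon : ℝ) (X : Fin N → E) (x : E) (w : Fin N → ℝ) :
    ℝ :=
  k x x - 2 * (kernelVector k X x ⬝ᵥ w) + w ⬝ᵥ (noisyKernelMatrix k σon X).mulVec w

theorem dotProduct_noisyKernelMatrix_mulVec (k : E → E → ℝ) (σon : ℝ) (X : Fin N → E)
    (w : Fin N → ℝ) :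
    w ⬝ᵥ (noisyKernelMatrix k σon X).mulVec w =
      (∑ i, ∑ j, w i * w j * k (X i) (X j)) + σon ^ 2 * ∑ i, w i ^ 2 := by
  rw [noisyKernelMatrix, Matrix.add_mulVec, dotProduct_add, Matrix.smul_mulVec,
    Matrix.one_mulVec, dotProduct_smul]
  congr 1
  · simp only [dotProduct, Matrix.mulVec, kernelMatrix, Matrix.of_apply, Finset.mul_sum]
    exact Finset.sum_congr rfl fun i _ => Finset.sum_congr rfl fun j _ => by ring
  · simp [dotProduct, sq]

theorem IsKernel.posDef_noisyKernelMatrix {k : E → E → ℝ} (hk : IsKernel k) {σon : ℝ}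
    (hσ : 0 < σon) (X : Fin N → E) : (noisyKernelMatrix k σon X).PosDef := by
  refine Matrix.PosDef.of_dotProduct_mulVec_pos ?_ fun {w} hw => ?_
  · ext i j
    simp [noisyKernelMatrix, kernelMatrix, Matrix.one_apply, hk.1 (X i) (X j), eq_comm]
  · rw [star_trivial, dotProduct_noisyKernelMatrix_mulVec]
    obtain ⟨i, hi⟩ := Function.ne_iff.mp hw
    have h1 : 0 < ∑ i, w i ^ 2 :=
      Finset.sum_pos' (fun i _ => sq_nonneg _) ⟨i, Finset.mem_univ _, by
        have : w i ≠ 0 := hi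
        positivity⟩
    have := hk.2 N X w
    positivity

/-- The weights of the posterior mean as a linear predictor. -/
noncomputable def postWeights (k : E → E → ℝ) (σon : ℝ) (X : Fin N → E) (x : E) : Fin N → ℝ :=
  (noisyKernelMatrix k σon X)⁻¹.mulVec (kernelVector k X x)

/-- Completing the square: the error is a quadratic in `w` with positive definite Hessian, minimised
by the posterior weights. -/
theorem IsKernel.linearError_eq {k : E → E → ℝ} (hk : IsKernel k) {σon : ℝ}
    (hσ : 0 < σon) (X : Fin N → E) (x : E) (w : Fin N → ℝ) :
    linearError k σon X x w = postVar k σon X x +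
      (w - postWeights k σon X x) ⬝ᵥ
        (noisyKernelMatrix k σon X).mulVec (w - postWeights k σon X x) := by
  have hpd := hk.posDef_noisyKernelMatrix hσ X
  set K := noisyKernelMatrix k σon X with hK
  set v := kernelVector k X x with hv
  set u := postWeights k σon X x with hu
  have hKu : K.mulVec u = v := by
    rw [hu, postWeights, Matrix.mulVec_mulVec, ← hK,
      Matrix.mul_nonsing_inv _ ((Matrix.isUnit_iff_isUnit_det _).mp hpd.isUnit), Matrix.one_mulVec]
  have hT : K.transpose = K := by simpa using hpd.isHermitian.eq
  have hsymm : u ⬝ᵥ K.mulVec w = w ⬝ᵥ v := by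
    rw [Matrix.dotProduct_mulVec, ← Matrix.mulVec_transpose, hT, hKu, dotProduct_comm]
  have hpv : postVar k σon X x = k x x - v ⬝ᵥ u := rfl
  rw [hpv, linearError, ← hK, ← hv, Matrix.mulVec_sub, hKu, dotProduct_sub, sub_dotProduct,
    sub_dotProduct, hsymm, dotProduct_comm v w, dotProduct_comm v u]
  ring

theorem IsKernel.postVar_le_linearError {k : E → E → ℝ} (hk : IsKernel k) {σon : ℝ}
    (hσ : 0 < σon) (X : Fin N → E) (x : E) (w : Fin N → ℝ) :
    postVar k σon X x ≤ linearError k σon X x w := by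
  rw [hk.linearError_eq hσ]
  have := (hk.posDef_noisyKernelMatrix hσ X).posSemidef.dotProduct_mulVec_nonneg
    (w - postWeights k σon X x)
  rw [star_trivial] at this
  linarith

theorem IsKernel.linearError_postWeights {k : E → E → ℝ} (hk : IsKernel k) {σon : ℝ}
    (hσ : 0 < σon) (X : Fin N → E) (x : E) :
    linearError k σon X x (postWeights k σon X x) = postVar k σon X x := by
  simp [hk.linearError_eq hσ]

theorem IsKernel.postVar_le_self {k : E → E → ℝ} (hk : IsKernel k) {σon : ℝ}
    (hσ : 0 < σon) (X : Fin N → E) (x : E) : postVar k σon X x ≤ k x x := by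
  simpa [linearError] using hk.postVar_le_linearError hσ X x 0

theorem IsKernel.postMean_eq {k : E → E → ℝ} (hk : IsKernel k) {σon : ℝ}
    (hσ : 0 < σon) (X : Fin N → E) (y : Fin N → ℝ) (x : E) :
    postMean k σon X y x = ∑ j, postWeights k σon X x j * y j := by
  have hT : (noisyKernelMatrix k σon X).transpose = noisyKernelMatrix k σon X := by
    simpa using (hk.posDef_noisyKernelMatrix hσ X).isHermitian.eq
  rw [postMean, postWeights, Matrix.dotProduct_mulVec, ← Matrix.mulVec_transpose,
    Matrix.transpose_nonsing_inv, hT]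
  rfl

theorem IsKernel.self_nonneg {k : E → E → ℝ} (hk : IsKernel k) (x : E) : 0 ≤ k x x := by
  simpa using hk.2 1 (fun _ => x) (fun _ => 1)

theorem IsKernel.two_mul_abs_le {k : E → E → ℝ} (hk : IsKernel k) (x x' : E) :
    2 * |k x x'| ≤ k x x + k x' x' := by
  have h1 := hk.2 2 ![x, x'] ![1, 1]
  have h2 := hk.2 2 ![x, x'] ![1, -1]
  simp [Fin.sum_univ_two, hk.1 x' x] at h1 h2
  rcases abs_cases (k x x') with h | h <;> linarith

/-- A kernel of constant variance `c`: the posterior variance is at most `2 / (ρ c)`, where `ρ` is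
the data density. -/
theorem IsKernel.dataDensity_mul_le {k : E → E → ℝ} (hk : IsKernel k) {σon c : ℝ}
    (hσ : 0 < σon) (hc : 0 < c) (hdiag : ∀ x, k x x = c) (X : Fin N → E) (x : E) :
    dataDensity k σon X x * (c * postVar k σon X x) ≤ 2 := by
  rcases le_or_gt (postVar k σon X x) 0 with hv | hv
  · have h0 : 0 ≤ dataDensity k σon X x := Real.sSup_nonneg fun r hr => hr.1.le
    nlinarith [mul_nonneg h0 (mul_nonneg hc.le (neg_nonneg.mpr hv))]
  rw [← le_div_iff₀ (by positivity)]
  -- It suffices to bound each admissible `r`; nonnegativity of the bound covers the default value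
  -- `0` of `sSup`.
  refine Real.sSup_le ?_ (by positivity)
  rintro r ⟨hr, hcard⟩
  rw [hdiag] at hcard
  set S := kernelNbhd k X r x with hS
  classical
  set T := S.toFinset with hT
  have hn : (S.ncard : ℝ) = T.card := by rw [Set.ncard_eq_toFinset_card']
  rw [hn] at hcard
  set n : ℝ := (T.card : ℝ) with hn'
  have hnpos : 0 < n := lt_of_lt_of_le (by positivity) hcard
  have hsymm : ∀ i, k (X i) x = k x (X i) := fun i => hk.1 _ _
  have hmem : ∀ i ∈ T, c ^ 2 - 1 / r ≤ k x (X i) ^ 2 := by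
    intro i hi
    have := (Set.mem_toFinset.mp hi).2
    rw [hdiag, hsymm] at this
    linarith
  set P := ∑ i ∈ T, k x (X i) ^ 2 with hP
  have hPge : n * (c ^ 2 - 1 / r) ≤ P := by
    simpa [nsmul_eq_mul] using Finset.card_nsmul_le_sum T _ _ hmem
  have hPnn : 0 ≤ P := Finset.sum_nonneg fun _ _ => sq_nonneg _
  have hD : 0 < c * n + σon ^ 2 := by positivity
  -- Test weights `a * k x (X i)` on the neighbourhood. As `|k| ≤ c`, the error is at most `c - 2 a
  -- P + a² (c n + σon²) P`, which this `a` minimises.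
  set a := 1 / (c * n + σon ^ 2) with ha
  have hanon : 0 ≤ a := by positivity
  have key := hk.postVar_le_linearError hσ X x (fun i => if i ∈ T then a * k x (X i) else 0)
  rw [linearError, dotProduct_noisyKernelMatrix_mulVec, hdiag] at key
  have e1 : kernelVector k X x ⬝ᵥ (fun i => if i ∈ T then a * k x (X i) else 0) = a * P := by
    simp only [dotProduct, kernelVector, mul_ite, mul_zero, Finset.sum_ite_mem, Finset.univ_inter,
      hP, Finset.mul_sum]
    exact Finset.sum_congr rfl fun i _ => by ring
  have e2 : ∑ i, (if i ∈ T then a * k x (X i) else 0) ^ 2 = a ^ 2 * P := by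
    simp only [ite_pow, ne_eq, OfNat.ofNat_ne_zero, not_false_eq_true, zero_pow,
      Finset.sum_ite_mem, Finset.univ_inter, hP, Finset.mul_sum]
    exact Finset.sum_congr rfl fun i _ => by ring
  have e3 : ∑ i, ∑ j, (if i ∈ T then a * k x (X i) else 0) *
      (if j ∈ T then a * k x (X j) else 0) * k (X i) (X j) ≤ a ^ 2 * (c * n * P) := by
    have h1 : ∑ i, ∑ j, (if i ∈ T then a * k x (X i) else 0) *
        (if j ∈ T then a * k x (X j) else 0) * k (X i) (X j) =
        ∑ i ∈ T, ∑ j ∈ T, a ^ 2 * (k x (X i) * k x (X j) * k (X i) (X j)) := by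
      rw [← Finset.sum_subset (Finset.subset_univ T) fun i _ hi => by simp [hi]]
      refine Finset.sum_congr rfl fun i hi => ?_
      rw [← Finset.sum_subset (Finset.subset_univ T) fun j _ hj => by simp [hj]]
      refine Finset.sum_congr rfl fun j hj => ?_
      rw [if_pos hi, if_pos hj]
      ring
    have h2 : ∀ i ∈ T, ∀ j ∈ T, a ^ 2 * (k x (X i) * k x (X j) * k (X i) (X j)) ≤
        a ^ 2 * (c * ((k x (X i) ^ 2 + k x (X j) ^ 2) / 2)) := by
      intro i _ j _
      refine mul_le_mul_of_nonneg_left ?_ (sq_nonneg a)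
      have hb := hk.two_mul_abs_le (X i) (X j)
      rw [hdiag, hdiag] at hb
      have hb' : |k (X i) (X j)| ≤ c := by linarith
      calc k x (X i) * k x (X j) * k (X i) (X j)
          ≤ |k x (X i) * k x (X j)| * |k (X i) (X j)| := by
            rw [← abs_mul]; exact le_abs_self _
        _ ≤ |k x (X i) * k x (X j)| * c := by gcongr
        _ ≤ (k x (X i) ^ 2 + k x (X j) ^ 2) / 2 * c := by
            gcongr
            rw [abs_le]
            constructor <;> nlinarith [sq_nonneg (k x (X i) + k x (X j)),
              sq_nonneg (k x (X i) - k x (X j))]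
        _ = _ := by ring
    rw [h1]
    refine (Finset.sum_le_sum fun i hi => Finset.sum_le_sum fun j hj => h2 i hi j hj).trans_eq ?_
    simp only [← Finset.mul_sum, ← Finset.sum_div, Finset.sum_add_distrib, Finset.sum_const,
      nsmul_eq_mul, ← hn', ← hP]
    ring
  rw [e1, e2] at key
  have haD : a * (c * n + σon ^ 2) = 1 := by rw [ha]; field_simp
  have hle : postVar k σon X x ≤ c - a * P := by
    have : a ^ 2 * (c * n * P) + σon ^ 2 * (a ^ 2 * P) = a * P := by
      calc _ = a * (c * n + σon ^ 2) * (a * P) := by ring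
        _ = a * P := by rw [haD, one_mul]
    linarith
  have hle2 : postVar k σon X x * (c * n + σon ^ 2) ≤ c * σon ^ 2 + n / r := by
    calc _ ≤ (c - a * P) * (c * n + σon ^ 2) := by gcongr
      _ = c * (c * n + σon ^ 2) - (a * (c * n + σon ^ 2)) * P := by ring
      _ ≤ c * (c * n + σon ^ 2) - n * (c ^ 2 - 1 / r) := by rw [haD, one_mul]; linarith
      _ = _ := by ring
  have hle3 : postVar k σon X x * (c * n) ≤ 2 * n / r := by
    -- The cardinality condition makes the noise term no larger than the neighbourhood term, whence
    -- the factor 2.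
    have h5 : c * σon ^ 2 ≤ n / r := by
      rw [le_div_iff₀ hr]; linarith
    have : 0 ≤ postVar k σon X x * σon ^ 2 := by positivity
    calc _ ≤ c * σon ^ 2 + n / r := by linarith
      _ ≤ n / r + n / r := by linarith
      _ = _ := by ring
  rw [le_div_iff₀ (by positivity)]
  rw [le_div_iff₀ hr] at hle3
  have : (r * (c * postVar k σon X x)) * n ≤ 2 * n := by linarith
  exact le_of_mul_le_mul_right this hnpos

/-- Every `ρ' > 0` qualifies, so the set is unbounded and `sSup` takes its default value. A positive
density therefore forces `k(0) > 0`. -/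
theorem dataDensity_eq_zero {k : E → E → ℝ} {σon : ℝ} {X : Fin N → E} {x : E} (h : k x x = 0) :
    dataDensity k σon X x = 0 := by
  refine Real.sSup_of_not_bddAbove fun ⟨B, hB⟩ => ?_
  have : max B 0 + 1 ≤ B := hB ⟨by positivity, by rw [h]; simp⟩
  linarith [le_max_left B 0]

theorem minDataDensity_le (k : E → E → ℝ) (σon : ℝ) (X : Fin N → E) (xref : ℝ → E) {t : ℝ}
    (ht : 0 ≤ t) : minDataDensity k σon X xref ≤ dataDensity k σon X (xref t) :=
  csInf_le ⟨0, by rintro _ ⟨s, -, rfl⟩; exact Real.sSup_nonneg fun r hr => hr.1.le⟩ ⟨t, ht, rfl⟩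

theorem minDataDensity_eq_zero {k : E → E → ℝ} {σon : ℝ} {X : Fin N → E} {xref : ℝ → E}
    (h : ∀ x, k x x = 0) : minDataDensity k σon X xref = 0 := by
  have : (fun t => dataDensity k σon X (xref t)) = fun _ => 0 :=
    funext fun t => dataDensity_eq_zero (h _)
  rw [minDataDensity, this, Set.Nonempty.image_const nonempty_Ici, csInf_singleton]

end Regression

end GPTracking

namespace GPTracking

/-! ### Covering numbers and the Lipschitz constant of the kernel metric -/

section Geometry

/-- Nearest-point projection onto a convex set brings a centre no farther from any point of the set.
The centres of a cover may thus be taken in `𝕏`, where the sampling model applies, without changing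
`β`. -/
theorem coveringNumber_eq_externalCoveringNumber {F : Type*} [NormedAddCommGroup F]
    [InnerProductSpace ℝ F] {K : Set F} (hK : Convex ℝ K) (hK' : IsCompact K) (r : ℝ≥0) :
    Metric.coveringNumber r K = Metric.externalCoveringNumber r K := by
  refine le_antisymm ?_ (Metric.externalCoveringNumber_le_coveringNumber r K)
  rcases K.eq_empty_or_nonempty with rfl | hne
  · simp
  have hproj : ∀ u : F, ∃ v ∈ K, ‖u - v‖ = ⨅ w : K, ‖u - w‖ :=
    exists_norm_eq_iInf_of_complete_convex hne hK'.isComplete hK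
  choose p hpK hp using hproj
  refine le_iInf₂ fun C hC => ?_
  refine (Metric.IsCover.coveringNumber_le_encard (C := p '' C) ?_ ?_).trans
    (Set.encard_image_le p C)
  · rintro _ ⟨c, -, rfl⟩
    exact hpK c
  · intro x hx
    obtain ⟨c, hc, hxc⟩ := hC hx
    refine ⟨p c, ⟨c, hc, rfl⟩, ?_⟩
    have h1 := (norm_eq_iInf_iff_real_inner_le_zero hK (hpK c)).mp (hp c) x hx
    have h2 : dist x (p c) ≤ dist x c := by
      rw [dist_eq_norm, dist_eq_norm]
      have e : x - c = (x - p c) - (c - p c) := by abel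
      have := norm_sub_sq_real (x - p c) (c - p c)
      rw [← e, real_inner_comm] at this
      nlinarith [sq_nonneg ‖c - p c‖, norm_nonneg (x - c), norm_nonneg (x - p c)]
    simp only [Set.mem_ofPred_eq] at hxc ⊢
    rw [edist_dist] at *
    exact (ENNReal.ofReal_le_ofReal h2).trans hxc

theorem exists_finset_cover {F : Type*} [NormedAddCommGroup F]
    [InnerProductSpace ℝ F] {K : Set F} (hK : Convex ℝ K) (hK' : IsCompact K) {τ : ℝ}
    (hτ : 0 < τ) :
    ∃ C : Finset F, (C : Set F) ⊆ K ∧ (∀ x ∈ K, ∃ c ∈ C, dist x c ≤ τ) ∧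
      C.card = (Metric.externalCoveringNumber τ.toNNReal K).toNat := by
  have hτ' : 0 < τ.toNNReal := by simpa using hτ
  have hfin : Metric.coveringNumber τ.toNNReal K ≠ ⊤ := by
    obtain ⟨C, hCK, hCfin, hC⟩ := Metric.exists_finite_isCover_of_isCompact hτ'.ne' hK'
    exact ne_top_of_le_ne_top hCfin.encard_lt_top.ne (hC.coveringNumber_le_encard hCK)
  obtain ⟨C, hCK, hCfin, hC, hcard⟩ := Metric.exists_set_encard_eq_coveringNumber hfin
  refine ⟨hCfin.toFinset, by simpa using hCK, fun x hx => ?_, ?_⟩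
  · obtain ⟨c, hc, hxc⟩ := hC hx
    refine ⟨c, by simpa using hc, ?_⟩
    simp only [Set.mem_ofPred_eq] at hxc
    rw [edist_dist] at hxc
    have := (ENNReal.ofReal_le_iff_le_toReal (by simp)).mp hxc
    simpa [hτ.le] using this
  · rw [← coveringNumber_eq_externalCoveringNumber hK hK', ← hcard, ← Set.ncard_eq_toFinset_card _ hCfin]
    rfl

theorem one_le_toNat_externalCoveringNumber {F : Type*} [PseudoMetricSpace F] {K : Set F}
    (hK : IsCompact K) (hne : K.Nonempty) {τ : ℝ} (hτ : 0 < τ) :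
    1 ≤ (Metric.externalCoveringNumber τ.toNNReal K).toNat := by
  have hτ' : 0 < τ.toNNReal := by simpa using hτ
  obtain ⟨C, -, hCfin, hC⟩ := Metric.exists_finite_isCover_of_isCompact hτ'.ne' hK
  have hfin := ne_top_of_le_ne_top hCfin.encard_lt_top.ne hC.externalCoveringNumber_le_encard
  rw [Nat.one_le_iff_ne_zero, ne_eq, ENat.toNat_eq_zero, not_or]
  exact ⟨(Metric.externalCoveringNumber_pos_iff.mpr hne).ne', hfin⟩

variable {d : ℕ}

theorem beta_pos {𝕏 : Set (State d)} (h𝕏 : IsCompact 𝕏) (hne : 𝕏.Nonempty) {δ τ : ℝ}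
    (hδ : δ ∈ Ioo (0 : ℝ) 1) (hτ : 0 < τ) : 0 < beta 𝕏 δ τ := by
  have h1 : (1 : ℝ) ≤ (Metric.externalCoveringNumber τ.toNNReal 𝕏).toNat := by
    exact_mod_cast one_le_toNat_externalCoveringNumber h𝕏 hne hτ
  refine mul_pos two_pos (Real.log_pos ?_)
  rw [one_lt_div hδ.1]
  exact hδ.2.trans_le h1

theorem lipStd_nonneg (k : State d → ℝ) (𝕏 : Set (State d)) : 0 ≤ lipStd k 𝕏 := by
  refine Real.sSup_nonneg ?_
  rintro _ ⟨x, -, x', -, -, rfl⟩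
  positivity

/-- A function with derivative at most `C` where it is positive grows at most linearly from `0`. -/
theorem le_of_deriv_le_of_pos {g g' : ℝ → ℝ} {C : ℝ} (hC : 0 ≤ C) (hg : ContinuousOn g (Icc 0 1))
    (h0 : g 0 ≤ 0)
    (hg' : ∀ s ∈ Ioo (0 : ℝ) 1, 0 < g s → HasDerivAt g (g' s) s ∧ g' s ≤ C) : g 1 ≤ C := by
  by_contra! hlt
  have hne : ({s ∈ Icc (0 : ℝ) 1 | g s ≤ 0}).Nonempty := ⟨0, by simp, h0⟩
  have hcl : IsCompact {s ∈ Icc (0 : ℝ) 1 | g s ≤ 0} :=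
    isCompact_Icc.of_isClosed_subset (hg.preimage_isClosed_of_isClosed isClosed_Icc isClosed_Iic)
      (fun s hs => hs.1)
  -- Beyond the last point `a` with `g a ≤ 0` the derivative bound is available, and the mean value
  -- theorem applies on `[a, 1]`.
  obtain ⟨a, ⟨ha, hga⟩, hmax⟩ := hcl.exists_isGreatest hne
  have ha1 : a < 1 := lt_of_le_of_ne ha.2 (by rintro rfl; linarith)
  have hpos : ∀ s ∈ Ioo a 1, 0 < g s := by
    intro s hs
    by_contra! h
    exact absurd (hmax ⟨⟨ha.1.trans hs.1.le, hs.2.le⟩, h⟩) (not_le.mpr hs.1)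
  obtain ⟨s, hs, hsl⟩ := exists_hasDerivAt_eq_slope g g' ha1
    (hg.mono (Icc_subset_Icc_left ha.1))
    (fun s hs => (hg' s ⟨ha.1.trans_lt hs.1, hs.2⟩ (hpos s hs)).1)
  have h2 := (hg' s ⟨ha.1.trans_lt hs.1, hs.2⟩ (hpos s hs)).2
  rw [hsl, div_le_iff₀ (by linarith)] at h2
  nlinarith [ha.1]

/-- Differentiate along `s ↦ s • r`; convexity keeps `s • r` a difference of points of `𝕏`. The root
may fail to be differentiable where it vanishes, which is why only positive values are tested. -/
theorem sqrt_sub_le_lipStd_mul {k : State d → ℝ} {𝕏 : Set (State d)} (h𝕏 : Convex ℝ 𝕏)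
    (hk : Differentiable ℝ k) (hL : BddAbove (kernelSlopes k 𝕏))
    {x x' : State d} (hx : x ∈ 𝕏) (hx' : x' ∈ 𝕏) :
    √(2 * k 0 - 2 * k (x - x')) ≤ lipStd k 𝕏 * ‖x - x'‖ := by
  set r := x - x' with hr
  have key := le_of_deriv_le_of_pos (g := fun s : ℝ => √(2 * k 0 - 2 * k (s • r)))
    (g' := fun s => (-(2 * inner ℝ (gradient k (s • r)) r)) / (2 * √(2 * k 0 - 2 * k (s • r))))
    (C := lipStd k 𝕏 * ‖r‖) (mul_nonneg (lipStd_nonneg _ _) (norm_nonneg _))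
    (by
      have := hk.continuous
      fun_prop) (by simp) ?_
  · simpa using key
  intro s hs hpos
  have hpos' : 0 < 2 * k 0 - 2 * k (s • r) := Real.sqrt_pos.mp hpos
  constructor
  · have h1 : HasDerivAt (fun s : ℝ => s • r) r s := by
      simpa using (hasDerivAt_id s).smul_const r
    have h2 := (hk (s • r)).hasGradientAt.hasFDerivAt.comp_hasDerivAt s h1
    have h3 := ((h2.const_mul 2).const_sub (2 * k 0)).sqrt hpos'.ne'
    simpa using h3
  · have hmem : x' + s • r ∈ 𝕏 := h𝕏.add_smul_sub_mem hx' hx ⟨hs.1.le, hs.2.le⟩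
    have hsl : √(1 / (2 * k 0 - 2 * k (s • r))) * ‖gradient k (s • r)‖ ≤ lipStd k 𝕏 := by
      refine le_csSup hL ⟨x' + s • r, hmem, x', hx', ?_, ?_⟩
      · rw [add_sub_cancel_left]
        intro h
        rw [h] at hpos'
        simp at hpos'
      · rw [add_sub_cancel_left]
    have hin : -inner ℝ (gradient k (s • r)) r ≤ ‖gradient k (s • r)‖ * ‖r‖ :=
      (neg_le_abs _).trans (abs_real_inner_le_norm _ _)
    have hs' : 0 < √(2 * k 0 - 2 * k (s • r)) := hpos
    calc (-(2 * inner ℝ (gradient k (s • r)) r)) / (2 * √(2 * k 0 - 2 * k (s • r)))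
        = (-inner ℝ (gradient k (s • r)) r) / √(2 * k 0 - 2 * k (s • r)) := by
          field_simp
      _ ≤ (‖gradient k (s • r)‖ * ‖r‖) / √(2 * k 0 - 2 * k (s • r)) := by gcongr
      _ = √(1 / (2 * k 0 - 2 * k (s • r))) * ‖gradient k (s • r)‖ * ‖r‖ := by
          rw [Real.sqrt_div zero_le_one, Real.sqrt_one]; ring
      _ ≤ _ := by gcongr

end Geometry

end GPTracking

namespace GPTracking

/-! ### Input-to-state bounds for the error dynamics -/

section Control

variable {d : ℕ}

/-- A scalar linear equation with decay rate at least `-l` and bounded input. -/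
theorem norm_le_of_scalar_linear {w : ℝ → ℂ} {g : ℝ → ℂ} {z : ℂ} {l Γ T : ℝ} (hl : l < 0)
    (hz : z.re ≤ l) (hΓ : 0 ≤ Γ)
    (hw : ∀ t, 0 ≤ t → HasDerivWithinAt w (z * w t + g t) (Ici 0) t) (h0 : w 0 = 0)
    (hg : ∀ t ∈ Icc 0 T, ‖g t‖ ≤ Γ) {t : ℝ} (ht : t ∈ Icc 0 T) : ‖w t‖ ≤ Γ / -l := by
  set a := -z.re with ha
  have hapos : 0 < a := by linarith
  have hexp : ∀ s : ℝ, HasDerivAt (fun s : ℝ => Complex.exp (-z * s))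
      (Complex.exp (-z * s) * (-z)) s := by
    intro s
    have := ((Complex.ofRealCLM.hasDerivAt (x := s)).const_mul (-z)).cexp
    simpa using this
  have hnorm : ∀ s : ℝ, ‖Complex.exp (-z * s)‖ = Real.exp (a * s) := by
    intro s; rw [Complex.norm_exp]; simp [ha]
  have hp : ∀ s : ℝ, 0 ≤ s → HasDerivWithinAt (fun s : ℝ => Complex.exp (-z * s) * w s)
      (Complex.exp (-z * s) * g s) (Ici 0) s := by
    intro s hs
    refine ((hexp s).hasDerivWithinAt.mul (hw s hs)).congr_deriv ?_
    ring
  have hB : ∀ s : ℝ, HasDerivAt (fun s : ℝ => Γ * ((Real.exp (a * s) - 1) / a))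
      (Γ * Real.exp (a * s)) s := by
    intro s
    have h1 : HasDerivAt (fun s : ℝ => Real.exp (a * s)) (Real.exp (a * s) * a) s := by
      simpa using ((hasDerivAt_id s).const_mul a).exp
    refine (((h1.sub_const 1).div_const a).const_mul Γ).congr_deriv ?_
    field_simp
  -- Integrating factor: `exp (-z t) w` has derivative of norm at most `Γ exp (a t)`, so it stays
  -- below the primitive `Γ (exp (a t) - 1) / a`.
  have key := image_norm_le_of_norm_deriv_right_le_deriv_boundary
    (f := fun s : ℝ => Complex.exp (-z * s) * w s) (a := 0) (b := T)
    (f' := fun s => Complex.exp (-z * s) * g s)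
    (fun s hs => ((hp s hs.1).continuousWithinAt).mono Icc_subset_Ici_self)
    (fun s hs => (hp s hs.1).mono (Ici_subset_Ici.mpr hs.1)) (by simp [h0]) hB
    (fun s hs => by
      rw [norm_mul, hnorm, mul_comm]
      gcongr
      exact hg s ⟨hs.1, hs.2.le⟩) ht
  rw [norm_mul, hnorm] at key
  have hpos := Real.exp_pos (a * t)
  have h1 : ‖w t‖ ≤ Γ / a := by
    rw [le_div_iff₀ hapos]
    have : Real.exp (a * t) * ‖w t‖ * a ≤ Γ * (Real.exp (a * t) - 1) := by
      calc _ ≤ (Γ * ((Real.exp (a * t) - 1) / a)) * a := by gcongr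
        _ = _ := by field_simp
    have h2 : Real.exp (a * t) * (‖w t‖ * a) ≤ Real.exp (a * t) * Γ := by linarith
    exact le_of_mul_le_mul_left h2 hpos
  refine h1.trans ?_
  gcongr <;> linarith

theorem re_le_lamMax {M : Matrix (Fin d) (Fin d) ℝ} {U : Matrix (Fin d) (Fin d) ℂ}
    {Λ : Fin d → ℂ} (hU : IsUnit U) (h : complexify M = U * Matrix.diagonal Λ * U⁻¹) (i : Fin d) :
    (Λ i).re ≤ lamMax M := by
  obtain ⟨u, rfl⟩ := hU
  refine le_csSup ((Matrix.finite_spectrum _).image _).bddAbove ⟨Λ i, ?_, rfl⟩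
  rw [h, ← Matrix.coe_units_inv, spectrum.units_conjugate, spectrum_diagonal]
  exact mem_range_self i

theorem norm_mulVec_le_norm_mul_of_abs_le (U : Matrix (Fin d) (Fin d) ℂ) {v c : Fin d → ℂ} {B : ℝ}
    (hB : 0 ≤ B) (h : ∀ i, ‖v i‖ ≤ ‖c i‖ * B) :
    ‖WithLp.toLp 2 (U.mulVec v)‖ ≤
      ‖Matrix.toEuclideanCLM (n := Fin d) (𝕜 := ℂ) U‖ * ‖WithLp.toLp 2 c‖ * B := by
  have h1 : ‖WithLp.toLp 2 v‖ ≤ ‖WithLp.toLp 2 c‖ * B := by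
    rw [EuclideanSpace.norm_eq, EuclideanSpace.norm_eq]
    refine Real.sqrt_le_iff.mpr ⟨by positivity, ?_⟩
    rw [mul_pow, Real.sq_sqrt (by positivity), Finset.sum_mul]
    refine Finset.sum_le_sum fun i _ => ?_
    rw [← mul_pow]
    exact pow_le_pow_left₀ (norm_nonneg _) (h i) 2
  have h2 := (Matrix.toEuclideanCLM (n := Fin d) (𝕜 := ℂ) U).le_opNorm (WithLp.toLp 2 v)
  rw [Matrix.toEuclideanCLM_toLp] at h2
  refine h2.trans ?_
  rw [mul_assoc]
  gcongr

theorem norm_toLp_ofReal (e : State d) :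
    ‖WithLp.toLp 2 (fun i => ((e i : ℝ) : ℂ))‖ = ‖e‖ := by
  rw [EuclideanSpace.norm_eq, EuclideanSpace.norm_eq]
  simp

/-- Input-to-state bound for `ė = M e + g b` with `e(0) = 0` on `[0, T]`. -/
theorem norm_le_of_linear_system {M : Matrix (Fin d) (Fin d) ℝ} {b : State d}
    {U : Matrix (Fin d) (Fin d) ℂ} (hU : IsEigendecomposition M U) (hl : lamMax M < 0)
    {e : ℝ → State d} {g : ℝ → ℝ} {Γ T : ℝ} (hΓ : 0 ≤ Γ)
    (he : ∀ t, 0 ≤ t → HasDerivWithinAt e (Matrix.toEuclideanLin M (e t) + g t • b) (Ici 0) t)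
    (h0 : e 0 = 0) (hg : ∀ t ∈ Icc 0 T, |g t| ≤ Γ) {t : ℝ} (ht : t ∈ Icc 0 T) :
    ‖e t‖ ≤ zeta b U * (Γ / -lamMax M) := by
  obtain ⟨hunit, Λ, hΛ⟩ := hU
  have hdet := (Matrix.isUnit_iff_isUnit_det _).mp hunit
  set c : Fin d → ℂ := U⁻¹.mulVec fun i => ((b i : ℝ) : ℂ) with hc
  -- Eigencoordinates decouple the system into `v̇ᵢ = Λᵢ vᵢ + g cᵢ`.
  set v : ℝ → Fin d → ℂ := fun t => U⁻¹.mulVec fun i => ((e t i : ℝ) : ℂ) with hv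
  have hcoord : ∀ s, 0 ≤ s → ∀ i, HasDerivWithinAt (fun s => ((e s i : ℝ) : ℂ))
      ((complexify M).mulVec (fun j => ((e s j : ℝ) : ℂ)) i + g s * b i) (Ici 0) s := by
    intro s hs i
    have h1 := ((EuclideanSpace.proj (𝕜 := ℝ) i).hasFDerivAt.comp_hasDerivWithinAt s (he s hs))
    have h2 := h1.ofReal_comp
    refine (h2.congr_deriv ?_)
    simp [complexify, Matrix.mulVec, dotProduct]
  have hderiv : ∀ i, ∀ s, 0 ≤ s →
      HasDerivWithinAt (fun s => v s i) (Λ i * v s i + g s * c i) (Ici 0) s := by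
    intro i s hs
    have h1 : HasDerivWithinAt (fun s => ∑ j, U⁻¹ i j * ((e s j : ℝ) : ℂ))
        (∑ j, U⁻¹ i j *
          ((complexify M).mulVec (fun j => ((e s j : ℝ) : ℂ)) j + g s * b j)) (Ici 0) s :=
      HasDerivWithinAt.fun_sum fun j _ => (hcoord s hs j).const_mul _
    refine h1.congr_deriv ?_
    have h2 : U⁻¹.mulVec ((complexify M).mulVec (fun j => ((e s j : ℝ) : ℂ))) i = Λ i * v s i := by
      rw [Matrix.mulVec_mulVec, hΛ, ← mul_assoc, ← mul_assoc, Matrix.nonsing_inv_mul _ hdet,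
        one_mul, ← Matrix.mulVec_mulVec, Matrix.mulVec_diagonal]
    rw [← h2, hc]
    simp only [Matrix.mulVec, dotProduct, mul_add, Finset.sum_add_distrib, Finset.mul_sum]
    congr 1
    exact Finset.sum_congr rfl fun j _ => by ring
  have hvb : ∀ i, ‖v t i‖ ≤ ‖c i‖ * (Γ / -lamMax M) := by
    intro i
    rw [← mul_div_assoc]
    refine norm_le_of_scalar_linear hl (re_le_lamMax hunit hΛ i) (by positivity) (hderiv i) ?_ ?_ ht
    · simp [hv, h0, Matrix.mulVec, dotProduct]
    · intro s hs
      rw [norm_mul, Complex.norm_real, mul_comm]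
      gcongr
      exact hg s hs
  have hfin := norm_mulVec_le_norm_mul_of_abs_le U
    (div_nonneg hΓ (by linarith)) hvb
  rw [hv] at hfin
  simp only [Matrix.mulVec_mulVec, Matrix.mul_nonsing_inv _ hdet, Matrix.one_mulVec] at hfin
  rwa [norm_toLp_ofReal] at hfin

theorem zeta_nonneg (b : State d) (U : Matrix (Fin d) (Fin d) ℂ) : 0 ≤ zeta b U := by
  unfold zeta; positivity

/-- A perturbation growing linearly with the error leads to the loop gain
`lamMax M + zeta b U * L`. -/
theorem norm_le_of_linear_system_of_growth {M : Matrix (Fin d) (Fin d) ℝ} {b : State d}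
    {U : Matrix (Fin d) (Fin d) ℂ} (hU : IsEigendecomposition M U)
    {e : ℝ → State d} {g : ℝ → ℝ} {H L : ℝ} (hH : 0 ≤ H) (hL : 0 ≤ L)
    (hrate : lamMax M + zeta b U * L < 0)
    (he : ∀ t, 0 ≤ t → HasDerivWithinAt e (Matrix.toEuclideanLin M (e t) + g t • b) (Ici 0) t)
    (h0 : e 0 = 0) (hg : ∀ t, 0 ≤ t → |g t| ≤ H + L * ‖e t‖) {T : ℝ} (hT : 0 ≤ T) :
    ‖e T‖ ≤ zeta b U * H / -(lamMax M + zeta b U * L) := by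
  have hζ := zeta_nonneg b U
  have hl : lamMax M < 0 := by nlinarith [mul_nonneg hζ hL]
  have hcont : ContinuousOn (fun t => ‖e t‖) (Icc 0 T) := fun t ht =>
    ((he t ht.1).continuousWithinAt.mono Icc_subset_Ici_self).norm
  -- At a maximiser `s` of `‖e‖` on `[0, T]`, the input bound `H + L ‖e s‖` holds throughout the
  -- interval, so the inequality closes on `‖e s‖` itself.
  obtain ⟨s, hs, hmax⟩ := isCompact_Icc.exists_isMaxOn (nonempty_Icc.mpr hT) hcont
  have hS := norm_le_of_linear_system hU hl (Γ := H + L * ‖e s‖) (T := T) (by positivity) he h0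
    (fun t ht => (hg t ht.1).trans (by gcongr; exact hmax ht)) hs
  refine (hmax (right_mem_Icc.mpr hT)).trans ?_
  change ‖e s‖ ≤ _
  rw [le_div_iff₀ (by linarith)]
  rw [← mul_div_assoc, le_div_iff₀ (by linarith)] at hS
  linarith

theorem error_hasDerivWithinAt {A : Matrix (Fin d) (Fin d) ℝ} {b θ : State d} {𝕏 : Set (State d)}
    {f fhat : State d → ℝ} {xref x : ℝ → State d} {rref : ℝ → ℝ}
    (href : IsReference A b 𝕏 xref rref) (hx : IsClosedLoop A b 𝕏 f fhat θ xref rref x) {t : ℝ}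
    (ht : 0 ≤ t) :
    HasDerivWithinAt (fun t => x t - xref t)
      (Matrix.toEuclideanLin (closedLoopMatrix A b θ) (x t - xref t) + (f (x t) - fhat (x t)) • b)
      (Ici 0) t := by
  refine ((hx t ht).2.sub (href t ht).2).congr_deriv ?_
  ext i
  have h1 : ∀ y : State d, Matrix.toEuclideanLin (closedLoopMatrix A b θ) y =
      Matrix.toEuclideanLin A y - inner ℝ θ y • b := by
    intro y
    ext i
    simp [closedLoopMatrix, Matrix.vecMulVec_mulVec, PiLp.inner_apply,
      dotProduct, mul_comm]
  rw [h1, map_sub]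
  simp [control]
  ring

end Control

end GPTracking

namespace GPTracking

/-! ### Gaussian tails and the residual of the posterior mean -/

section Probability

/-- Translate by `m`: for `y > 0` the cross term `y m` in the exponent only helps. Keeping the mass
of the half-line is sharper than a Chernoff bound. -/
theorem gaussianReal_Ioi_le (v : ℝ≥0) (hv : v ≠ 0) {m : ℝ} (hm : 0 ≤ m) :
    gaussianReal 0 v (Ioi m) ≤
      ENNReal.ofReal (Real.exp (-(m ^ 2 / (2 * v)))) * gaussianReal 0 v (Ioi 0) := by
  have hv' : (0 : ℝ) < v := by positivity
  rw [gaussianReal_apply 0 hv, gaussianReal_apply 0 hv, ← lintegral_const_mul' _ _ (by simp),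
    ← lintegral_indicator measurableSet_Ioi, ← lintegral_indicator measurableSet_Ioi,
    ← lintegral_add_right_eq_self _ m]
  refine lintegral_mono fun y => ?_
  by_cases hy : 0 < y
  · have h1 : y + m ∈ Ioi m := by simpa using hy
    rw [indicator_of_mem h1, indicator_of_mem (show y ∈ Ioi (0 : ℝ) from hy), gaussianPDF,
      gaussianPDF, ← ENNReal.ofReal_mul (Real.exp_pos _).le]
    refine ENNReal.ofReal_le_ofReal ?_
    rw [gaussianPDFReal, gaussianPDFReal, mul_left_comm, ← Real.exp_add]
    refine mul_le_mul_of_nonneg_left (Real.exp_le_exp.mpr ?_) (by positivity)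
    rw [sub_zero, sub_zero, ← neg_div, ← add_div]
    gcongr
    nlinarith [mul_nonneg hy.le hm]
  · have h1 : y + m ∉ Ioi m := by simpa using hy
    rw [indicator_of_notMem h1]
    exact zero_le

/-- The sharp two-sided tail bound for centred Gaussian variables. -/
theorem gaussianReal_abs_gt_le (v : ℝ≥0) {c : ℝ} (hc : 0 ≤ c) :
    gaussianReal 0 v {x | c * √v < |x|} ≤ ENNReal.ofReal (Real.exp (-(c ^ 2 / 2))) := by
  rcases eq_or_ne v 0 with rfl | hv
  · rw [gaussianReal_zero_var, Measure.dirac_apply' _ (measurableSet_lt (by fun_prop) (by fun_prop))]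
    simp
  have hv' : (0 : ℝ) < v := by positivity
  have hm : 0 ≤ c * √v := by positivity
  have hneg : ∀ m : ℝ, gaussianReal 0 v (Iio (-m)) = gaussianReal 0 v (Ioi m) := by
    intro m
    have := gaussianReal_map_neg (μ := 0) (v := v)
    rw [neg_zero] at this
    conv_lhs => rw [← this, Measure.map_apply (by fun_prop) measurableSet_Iio]
    congr 1
    ext x
    simp
  have hsub : {x : ℝ | c * √v < |x|} ⊆ Ioi (c * √v) ∪ Iio (-(c * √v)) := by
    intro x hx
    rw [Set.mem_ofPred_eq] at hx
    rcases lt_abs.mp hx with h | h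
    · exact Or.inl h
    · exact Or.inr (by simp only [mem_Iio]; linarith)
  -- The two half-lines share mass at most one, so the two-sided bound has no factor 2, as `β = 2
  -- log (M / δ)` requires.
  have htot : gaussianReal 0 v (Ioi 0) + gaussianReal 0 v (Ioi 0) ≤ 1 := by
    nth_rewrite 2 [← hneg 0]
    rw [neg_zero]
    rw [← measure_union _ measurableSet_Iio]
    · exact prob_le_one
    · exact Set.disjoint_left.mpr fun x hx hx' => lt_asymm (mem_Ioi.mp hx) (mem_Iio.mp hx')
  have he : Real.exp (-((c * √v) ^ 2 / (2 * v))) = Real.exp (-(c ^ 2 / 2)) := by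
    rw [mul_pow, Real.sq_sqrt hv'.le]
    congr 1
    field_simp
  calc gaussianReal 0 v {x | c * √v < |x|}
      ≤ gaussianReal 0 v (Ioi (c * √v)) + gaussianReal 0 v (Iio (-(c * √v))) :=
        (measure_mono hsub).trans (measure_union_le _ _)
    _ ≤ ENNReal.ofReal (Real.exp (-(c ^ 2 / 2))) *
        (gaussianReal 0 v (Ioi 0) + gaussianReal 0 v (Ioi 0)) := by
        rw [hneg, mul_add, ← he]
        gcongr <;> exact gaussianReal_Ioi_le v hv hm
    _ ≤ ENNReal.ofReal (Real.exp (-(c ^ 2 / 2))) * 1 := by gcongr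
    _ = _ := mul_one _

/-- Minkowski's inequality, from Cauchy–Schwarz via the discriminant of `s ↦ Var[s U + V]`. -/
theorem sqrt_variance_add_le {Ω : Type*} [MeasurableSpace Ω] {Pr : Measure Ω}
    [IsProbabilityMeasure Pr] {U V : Ω → ℝ} (hU : MemLp U 2 Pr) (hV : MemLp V 2 Pr) :
    √(Var[U + V; Pr]) ≤ √(Var[U; Pr]) + √(Var[V; Pr]) := by
  have hquad : ∀ s : ℝ, 0 ≤ Var[U; Pr] * (s * s) + 2 * cov[U, V; Pr] * s + Var[V; Pr] := by
    intro s
    have h := variance_nonneg (s • U + V) Pr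
    rw [variance_add (hU.const_smul s) hV, variance_smul, covariance_smul_left] at h
    linarith
  have hd := discrim_le_zero hquad
  rw [discrim] at hd
  have hcov : cov[U, V; Pr] ≤ √(Var[U; Pr]) * √(Var[V; Pr]) := by
    rw [← Real.sqrt_mul (variance_nonneg _ _)]
    refine Real.le_sqrt_of_sq_le ?_
    linarith
  refine Real.sqrt_le_iff.mpr ⟨by positivity, ?_⟩
  rw [variance_add hU hV, add_sq, Real.sq_sqrt (variance_nonneg _ _),
    Real.sq_sqrt (variance_nonneg _ _)]
  linarith

variable {E Ω : Type*} {N : ℕ}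

/-- The error of the linear predictor of `f x` with weights `w` from noisy samples. -/
def residual (f : E → Ω → ℝ) (ε : Fin N → Ω → ℝ) (X : Fin N → E) (x : E) (w : Fin N → ℝ) :
    Ω → ℝ :=
  fun ω => f x ω - ∑ j, w j * (f (X j) ω + ε j ω)

theorem residual_eq (f : E → Ω → ℝ) (ε : Fin N → Ω → ℝ) (X : Fin N → E) (x : E) (w : Fin N → ℝ) :
    residual f ε X x w =
      (f x - ∑ j, w j • f (X j)) + ∑ j, (-w j) • ε j := by
  ext ω
  simp only [residual, mul_add, Finset.sum_add_distrib, Pi.add_apply, Pi.sub_apply,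
    Finset.sum_apply, Pi.smul_apply, smul_eq_mul, neg_mul, Finset.sum_neg_distrib]
  ring

variable [MeasurableSpace Ω] {Pr : Measure Ω} {k : E → E → ℝ} {σon : ℝ} {𝕏 : Set E}
  {f : E → Ω → ℝ} {ε : Fin N → Ω → ℝ}

namespace IsSamplingModel

theorem memLp (hM : IsSamplingModel Pr k σon 𝕏 f ε) {x : E} (hx : x ∈ 𝕏) : MemLp (f x) 2 Pr :=
  (hM.gaussian.hasGaussianLaw_eval ⟨x, hx⟩).memLp_two

theorem noise_gaussian (hM : IsSamplingModel Pr k σon 𝕏 f ε) (j : Fin N) :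
    HasGaussianLaw (ε j) Pr := (hM.noise_law j).hasGaussianLaw

theorem variance_noise (hM : IsSamplingModel Pr k σon 𝕏 f ε) (j : Fin N) :
    Var[ε j; Pr] = σon ^ 2 := by
  rw [(hM.noise_law j).variance_eq, variance_id_gaussianReal, Real.coe_toNNReal _ (sq_nonneg _)]

theorem integral_noise (hM : IsSamplingModel Pr k σon 𝕏 f ε) (j : Fin N) :
    ∫ ω, ε j ω ∂Pr = 0 := by
  rw [(hM.noise_law j).integral_eq, integral_id_gaussianReal]

variable {X : Fin N → E} {x x' : E}

theorem hasGaussianLaw_signal (hM : IsSamplingModel Pr k σon 𝕏 f ε) (hX : ∀ i, X i ∈ 𝕏)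
    (hx : x ∈ 𝕏) (w : Fin N → ℝ) : HasGaussianLaw (f x - ∑ j, w j • f (X j)) Pr := by
  let z : Option (Fin N) → 𝕏 := fun o => o.elim ⟨x, hx⟩ fun i => ⟨X i, hX i⟩
  let c : Option (Fin N) → ℝ := fun o => o.elim 1 fun i => -w i
  have h := ((hM.gaussian.comp_right z).smul c).hasGaussianLaw_sum (I := Finset.univ)
  refine h.congr (Eventually.of_forall fun ω => ?_)
  simp [Fintype.sum_option, z, c, sub_eq_add_neg]

theorem hasGaussianLaw_noise (hM : IsSamplingModel Pr k σon 𝕏 f ε) (w : Fin N → ℝ) :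
    HasGaussianLaw (∑ j, w j • ε j) Pr := by
  have h := (hM.noise_indep.hasGaussianLaw hM.noise_gaussian).map_fun
    (∑ j, w j • ContinuousLinearMap.proj (R := ℝ) (φ := fun _ : Fin N => ℝ) j)
  refine h.congr (Eventually.of_forall fun ω => ?_)
  simp

theorem indepFun_signal_noise (hM : IsSamplingModel Pr k σon 𝕏 f ε) (hX : ∀ i, X i ∈ 𝕏)
    (hx : x ∈ 𝕏) (w w' : Fin N → ℝ) :
    IndepFun (f x - ∑ j, w j • f (X j)) (∑ j, w' j • ε j) Pr := by
  have h := hM.noise_indep_f.comp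
    (φ := fun g : 𝕏 → ℝ => g ⟨x, hx⟩ - ∑ j, w j * g ⟨X j, hX j⟩)
    (ψ := fun e : Fin N → ℝ => ∑ j, w' j * e j) (by fun_prop) (by fun_prop)
  convert h using 1 <;> ext ω <;> simp

theorem variance_sum_noise (hM : IsSamplingModel Pr k σon 𝕏 f ε) (w : Fin N → ℝ) :
    Var[∑ j, w j • ε j; Pr] = σon ^ 2 * ∑ j, w j ^ 2 := by
  rw [IndepFun.variance_sum, Finset.mul_sum]
  · exact Finset.sum_congr rfl fun j _ => by rw [variance_smul, hM.variance_noise]; ring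
  · exact fun j _ => (hM.noise_gaussian j).memLp_two.const_smul _
  · intro i _ j _ hij
    exact (hM.noise_indep.indepFun hij).comp (measurable_const_smul (w i))
      (measurable_const_smul (w j))

theorem memLp_residual (hM : IsSamplingModel Pr k σon 𝕏 f ε) (hX : ∀ i, X i ∈ 𝕏)
    (hx : x ∈ 𝕏) (w : Fin N → ℝ) : MemLp (residual f ε X x w) 2 Pr := by
  rw [residual_eq]
  exact (hM.hasGaussianLaw_signal hX hx w).memLp_two.add (hM.hasGaussianLaw_noise _).memLp_two

variable [IsProbabilityMeasure Pr]

theorem variance_signal (hM : IsSamplingModel Pr k σon 𝕏 f ε) (hX : ∀ i, X i ∈ 𝕏)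
    (hx : x ∈ 𝕏) (w : Fin N → ℝ) :
    Var[f x - ∑ j, w j • f (X j); Pr] =
      k x x - 2 * (kernelVector k X x ⬝ᵥ w) + ∑ i, ∑ j, w i * w j * k (X i) (X j) := by
  have hL : ∀ j, MemLp (w j • f (X j)) 2 Pr := fun j => (hM.memLp (hX j)).const_smul _
  have hS : MemLp (∑ j, w j • f (X j)) 2 Pr := memLp_finsetSum' _ fun j _ => hL j
  have hfx := hM.memLp hx
  rw [variance_sub hfx hS, ← covariance_self hfx.aemeasurable, hM.cov_eq x hx x hx,
    ← covariance_self hS.aemeasurable, covariance_sum_right hL hfx,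
    covariance_sum_sum hL hL]
  congr 1
  · congr 2
    simp only [covariance_smul_right, dotProduct, kernelVector]
    exact Finset.sum_congr rfl fun j _ => by rw [hM.cov_eq x hx _ (hX j)]; ring
  · refine Finset.sum_congr rfl fun i _ => Finset.sum_congr rfl fun j _ => ?_
    rw [covariance_smul_left, covariance_smul_right, hM.cov_eq _ (hX i) _ (hX j)]
    ring

theorem variance_residual (hM : IsSamplingModel Pr k σon 𝕏 f ε) (hX : ∀ i, X i ∈ 𝕏)
    (hx : x ∈ 𝕏) (w : Fin N → ℝ) :
    Var[residual f ε X x w; Pr] = linearError k σon X x w := by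
  rw [residual_eq, IndepFun.variance_add (hM.hasGaussianLaw_signal hX hx w).memLp_two
    (hM.hasGaussianLaw_noise _).memLp_two (hM.indepFun_signal_noise hX hx _ _),
    hM.variance_signal hX hx, hM.variance_sum_noise, linearError,
    dotProduct_noisyKernelMatrix_mulVec]
  simp only [neg_sq]
  ring

theorem integral_residual (hM : IsSamplingModel Pr k σon 𝕏 f ε) (hX : ∀ i, X i ∈ 𝕏)
    (hx : x ∈ 𝕏) (w : Fin N → ℝ) : ∫ ω, residual f ε X x w ω ∂Pr = 0 := by
  have hf : ∀ y ∈ 𝕏, Integrable (f y) Pr := fun y hy => (hM.memLp hy).integrable one_le_two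
  have hε : ∀ j, Integrable (ε j) Pr := fun j => (hM.noise_gaussian j).integrable
  have hs : ∀ j, Integrable (fun ω => w j * (f (X j) ω + ε j ω)) Pr := fun j =>
    ((hf _ (hX j)).add (hε j)).const_mul _
  unfold residual
  rw [integral_sub (hf x hx) (integrable_finsetSum _ fun j _ => hs j),
    integral_finsetSum _ fun j _ => hs j, hM.mean_zero x hx]
  simp only [integral_const_mul, integral_add (hf _ (hX _)) (hε _), hM.mean_zero _ (hX _),
    hM.integral_noise]
  simp

theorem measure_residual_gt_le (hM : IsSamplingModel Pr k σon 𝕏 f ε) (hX : ∀ i, X i ∈ 𝕏)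
    (hx : x ∈ 𝕏) (w : Fin N → ℝ) {c : ℝ} (hc : 0 ≤ c) :
    Pr {ω | c * √(linearError k σon X x w) < |residual f ε X x w ω|} ≤
      ENNReal.ofReal (Real.exp (-(c ^ 2 / 2))) := by
  have hG : HasGaussianLaw (residual f ε X x w) Pr := by
    rw [residual_eq]
    exact (IndepFun.hasGaussianLaw (hM.hasGaussianLaw_signal hX hx w) (hM.hasGaussianLaw_noise _)
      (hM.indepFun_signal_noise hX hx _ _)).add
  have hlaw := hG.map_eq_gaussianReal
  rw [hM.integral_residual hX hx, hM.variance_residual hX hx] at hlaw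
  have hnn : 0 ≤ linearError k σon X x w := by
    rw [← hM.variance_residual hX hx]
    exact variance_nonneg _ _
  have h := gaussianReal_abs_gt_le (linearError k σon X x w).toNNReal hc
  rw [← hlaw, Measure.map_apply_of_aemeasurable hG.aemeasurable
    (measurableSet_lt (by fun_prop) (by fun_prop)), Real.coe_toNNReal _ hnn] at h
  exact h

/-- Predict `f x'` with the optimal weights for `x`: the residual changes by `f x' - f x`, and these
weights are at best optimal for `x'`. -/
theorem postStd_le_add (hM : IsSamplingModel Pr k σon 𝕏 f ε) (hk : IsKernel k) (hσ : 0 < σon)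
    (hX : ∀ i, X i ∈ 𝕏) (hx : x ∈ 𝕏) (hx' : x' ∈ 𝕏) :
    postStd k σon X x' ≤ postStd k σon X x + √(k x' x' - 2 * k x' x + k x x) := by
  set w := postWeights k σon X x
  have h := sqrt_variance_add_le (hM.memLp_residual hX hx w) ((hM.memLp hx').sub (hM.memLp hx))
  have e : residual f ε X x w + (f x' - f x) = residual f ε X x' w := by
    ext ω
    simp [residual]
  rw [e, hM.variance_residual hX hx', hM.variance_residual hX hx, hk.linearError_postWeights hσ,
    variance_sub (hM.memLp hx') (hM.memLp hx), ← covariance_self (hM.memLp hx').aemeasurable,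
    ← covariance_self (hM.memLp hx).aemeasurable, hM.cov_eq _ hx' _ hx', hM.cov_eq _ hx' _ hx,
    hM.cov_eq _ hx _ hx] at h
  exact (Real.sqrt_le_sqrt (hk.postVar_le_linearError hσ X x' w)).trans h

/-- With high probability the posterior mean is accurate on a finite set. -/
theorem exists_event (hM : IsSamplingModel Pr k σon 𝕏 f ε) (hk : IsKernel k) (hσ : 0 < σon)
    (hX : ∀ i, X i ∈ 𝕏) (C : Finset E) (hC : (C : Set E) ⊆ 𝕏) {c : ℝ} (hc : 0 ≤ c) :
    ∃ G : Set Ω, MeasurableSet G ∧ 1 - C.card * Real.exp (-(c ^ 2 / 2)) ≤ Pr.real G ∧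
      ∀ ω ∈ G, ∀ z ∈ C,
        |f z ω - postMean k σon X (fun j => f (X j) ω + ε j ω) z| ≤ c * postStd k σon X z := by
  set B : Set Ω := ⋃ z ∈ C, {ω | c * √(linearError k σon X z (postWeights k σon X z)) <
    |residual f ε X z (postWeights k σon X z) ω|} with hB
  -- Residuals are only a.e. measurable, so the bad set is replaced by a measurable hull.
  have hPB : Pr (toMeasurable Pr B) ≤
      ENNReal.ofReal (C.card * Real.exp (-(c ^ 2 / 2))) := by
    rw [measure_toMeasurable]
    refine (measure_biUnion_finset_le _ _).trans ?_
    refine (Finset.sum_le_sum fun z hz =>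
      hM.measure_residual_gt_le hX (hC hz) (postWeights k σon X z) hc).trans ?_
    rw [Finset.sum_const, nsmul_eq_mul, ENNReal.ofReal_mul (by positivity), ENNReal.ofReal_natCast]
  refine ⟨(toMeasurable Pr B)ᶜ, (measurableSet_toMeasurable _ _).compl, ?_, fun ω hω z hz => ?_⟩
  · rw [probReal_compl_eq_one_sub (measurableSet_toMeasurable _ _)]
    have := ENNReal.toReal_le_of_le_ofReal (by positivity) hPB
    rw [measureReal_def]
    linarith
  · have h1 : ω ∉ B := fun h => hω (subset_toMeasurable _ _ h)
    simp only [hB, mem_iUnion, not_exists, Set.mem_ofPred_eq] at h1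
    have h2 := not_lt.mp (h1 z hz)
    rw [hk.linearError_postWeights hσ] at h2
    rw [hk.postMean_eq hσ]
    exact h2

end IsSamplingModel

end Probability

end GPTracking

namespace GPTracking

/-! ### The uniform error bound -/

section Tracking

variable {d : ℕ}

theorem gam_nonneg {k : State d → ℝ} {𝕏 : Set (State d)} {δ τ : ℝ} {Lf Lμ : ℝ≥0} (hτ : 0 ≤ τ) :
    0 ≤ gam k 𝕏 δ Lf Lμ τ := by
  have := lipStd_nonneg k 𝕏
  unfold gam
  positivity

theorem eta_nonneg {k : State d → ℝ} {σon : ℝ} {𝕏 : Set (State d)} {δ τ : ℝ} {Lf Lμ : ℝ≥0}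
    {N : ℕ} {X : Fin N → State d} {x : State d} (hτ : 0 ≤ τ) :
    0 ≤ eta k σon 𝕏 δ Lf Lμ τ X x := by
  have := gam_nonneg (k := k) (𝕏 := 𝕏) (δ := δ) (Lf := Lf) (Lμ := Lμ) hτ
  unfold eta postStd
  positivity

/-- The prior variance dominates the posterior one; thus the `sSup` in `ῡ` is a genuine supremum. -/
theorem bddAbove_eta {k : State d → ℝ} {σon : ℝ} (hk : IsKernel (stationary k)) (hσ : 0 < σon)
    (𝕏 : Set (State d)) (δ τ : ℝ) (Lf Lμ : ℝ≥0) {N : ℕ} (X : Fin N → State d)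
    (xref : ℝ → State d) :
    BddAbove ((fun t => eta k σon 𝕏 δ Lf Lμ τ X (xref t)) '' Ici 0) := by
  refine ⟨√(beta 𝕏 δ τ) * √(k 0) + gam k 𝕏 δ Lf Lμ τ, ?_⟩
  rintro _ ⟨t, -, rfl⟩
  have h := hk.postVar_le_self hσ X (xref t)
  rw [stationary, sub_self] at h
  have := Real.sqrt_le_sqrt h
  simp only [eta]
  gcongr
  exact this

variable {Ω : Type*} [MeasurableSpace Ω] {Pr : Measure Ω} [IsProbabilityMeasure Pr]
  {k : State d → ℝ} {σon : ℝ} {𝕏 : Set (State d)} {f : State d → Ω → ℝ} {N : ℕ}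
  {ε : Fin N → Ω → ℝ} {X : Fin N → State d}

theorem IsSamplingModel.postStd_le_add_lipStd
    (hM : IsSamplingModel Pr (stationary k) σon 𝕏 f ε) (hk : IsKernel (stationary k))
    (hσ : 0 < σon) (h𝕏 : Convex ℝ 𝕏) (hk_diff : Differentiable ℝ k)
    (hL : BddAbove (kernelSlopes k 𝕏)) (hX : ∀ i, X i ∈ 𝕏) {x x' : State d} (hx : x ∈ 𝕏)
    (hx' : x' ∈ 𝕏) :
    postStd (stationary k) σon X x' ≤
      postStd (stationary k) σon X x + lipStd k 𝕏 * ‖x' - x‖ := by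
  have h1 := hM.postStd_le_add hk hσ hX hx hx'
  have h2 := sqrt_sub_le_lipStd_mul h𝕏 hk_diff hL hx' hx
  have e : stationary k x' x' - 2 * stationary k x' x + stationary k x x =
      2 * k 0 - 2 * k (x' - x) := by
    simp only [stationary, sub_self]
    ring
  rw [e] at h1
  linarith

/-- The uniform error bound: on an event of probability at least `1 - δ`, the learning error is at
most `η`. -/
theorem IsSamplingModel.exists_event_abs_sub_le_eta
    (hM : IsSamplingModel Pr (stationary k) σon 𝕏 f ε) (hk : IsKernel (stationary k))
    (hσ : 0 < σon) (h𝕏 : Convex ℝ 𝕏) (h𝕏c : IsCompact 𝕏) (hne : 𝕏.Nonempty)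
    (hk_diff : Differentiable ℝ k) (hL : BddAbove (kernelSlopes k 𝕏)) (hX : ∀ i, X i ∈ 𝕏)
    {δ τ : ℝ} (hδ : δ ∈ Ioo (0 : ℝ) 1) (hτ : 0 < τ) (Lf Lμ : ℝ≥0) :
    ∃ G : Set Ω, MeasurableSet G ∧ 1 - δ ≤ Pr.real G ∧ ∀ ω ∈ G,
      let μ : State d → ℝ := postMean (stationary k) σon X (fun j => f (X j) ω + ε j ω)
      LipschitzOnWith Lf (fun x => f x ω) 𝕏 → LipschitzOnWith Lμ μ 𝕏 →
      ∀ x ∈ 𝕏, |f x ω - μ x| ≤ eta k σon 𝕏 δ Lf Lμ τ X x := by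
  obtain ⟨C, hC𝕏, hC, hcard⟩ := exists_finset_cover h𝕏 h𝕏c hτ
  obtain ⟨G, hG, hPG, hGb⟩ := hM.exists_event hk hσ hX C hC𝕏 (Real.sqrt_nonneg (beta 𝕏 δ τ))
  have hβ := beta_pos h𝕏c hne hδ hτ
  have hM1 : (0 : ℝ) < (Metric.externalCoveringNumber τ.toNNReal 𝕏).toNat := by
    exact_mod_cast one_le_toNat_externalCoveringNumber h𝕏c hne hτ
  refine ⟨G, hG, ?_, fun ω hω => ?_⟩
  -- The choice of `β` makes `M * exp (-β / 2) = δ`.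
  · refine le_trans (le_of_eq ?_) hPG
    rw [Real.sq_sqrt hβ.le, beta, mul_div_cancel_left₀ _ two_ne_zero, Real.exp_neg,
      Real.exp_log (div_pos hM1 hδ.1), hcard]
    field_simp
  · intro μ hLf hLμ x hx
    obtain ⟨z, hz, hxz⟩ := hC x hx
    have hz𝕏 := hC𝕏 hz
    have h1 : |f x ω - f z ω| ≤ Lf * τ := by
      rw [← Real.dist_eq]
      exact (hLf.dist_le_mul x hx z hz𝕏).trans (by gcongr)
    have h2 : |μ z - μ x| ≤ Lμ * τ := by
      rw [← Real.dist_eq]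
      exact (hLμ.dist_le_mul z hz𝕏 x hx).trans (by rw [dist_comm]; gcongr)
    have h3 : |f z ω - μ z| ≤ √(beta 𝕏 δ τ) * postStd (stationary k) σon X z := hGb ω hω z hz
    have h4 : postStd (stationary k) σon X z ≤
        postStd (stationary k) σon X x + lipStd k 𝕏 * τ := by
      refine (hM.postStd_le_add_lipStd hk hσ h𝕏 hk_diff hL hX hx hz𝕏).trans ?_
      have := lipStd_nonneg k 𝕏
      rw [← dist_eq_norm, dist_comm]
      gcongr
    have h5 : √(beta 𝕏 δ τ) * postStd (stationary k) σon X z ≤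
        √(beta 𝕏 δ τ) * (postStd (stationary k) σon X x + lipStd k 𝕏 * τ) := by gcongr
    calc |f x ω - μ x| = |(f x ω - f z ω) + (f z ω - μ z) + (μ z - μ x)| := by congr 1; ring
      _ ≤ |f x ω - f z ω| + |f z ω - μ z| + |μ z - μ x| := abs_add_three _ _ _
      _ ≤ _ := by
        unfold eta gam
        linarith

end Tracking

/-! ### The sign of the rate and the bound in terms of the density -/

namespace Problem

variable {d : ℕ} {P : Problem d} {D : Design d} {Θ : Set (State d)} {α : ℝ → ℝ} {κ : ℝ}

/-- Stability and the gain condition give `rate ≤ -α(‖θ‖) + α(‖θ‖) = 0`; zero is excluded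
separately. -/
theorem rate_neg (hstab : StabilizedBy P.A P.b Θ α) (hD : P.Admissible D Θ α κ) :
    P.rate D < 0 := by
  refine lt_of_le_of_ne ?_ hD.rate_ne_zero
  have h1 := (hstab.2 D.θ hD.gain_mem).2
  have h2 := hD.gain_cond
  unfold rate
  linarith

/-- The tracking error bound in terms of the data density. -/
theorem abs_upsilonBar_le (h𝕏 : IsCompact P.𝕏) (hδ : P.δ ∈ Ioo (0 : ℝ) 1) (hσ : 0 < P.σon)
    (hk : IsKernel (stationary P.k)) (hxref : ∀ t, 0 ≤ t → P.xref t ∈ P.𝕏)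
    (hD : P.Admissible D Θ α κ) (hρ : 0 < P.rhoMin D) :
    |P.upsilonBar D| ≤ |κ| * √(2 / P.k 0) * (1 / √(P.rhoMin D)) := by
  have hβ := beta_pos h𝕏 ⟨_, hxref 0 le_rfl⟩ hδ hD.tau_pos
  have hdiag : ∀ x, stationary P.k x x = P.k 0 := fun x => by rw [stationary, sub_self]
  have hk0 : 0 < P.k 0 := by
    refine lt_of_le_of_ne (hdiag 0 ▸ hk.self_nonneg 0) fun h => hρ.ne' ?_
    exact minDataDensity_eq_zero fun x => (hdiag x).trans h.symm
  set β := beta P.𝕏 P.δ D.τ with hβdef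
  set ρ := P.rhoMin D with hρdef
  -- Common bound for `γ / √β`, by the condition on `τ`, and for `σ` along the reference, by the
  -- density estimate.
  set q := √(2 / (P.k 0 * ρ)) with hq
  have hsβ : 0 < √β := Real.sqrt_pos.mpr hβ
  have hγ : gam P.k P.𝕏 P.δ P.Lf D.Lμ D.τ ≤ √β * q := by
    rw [hq, ← Real.sqrt_mul hβ.le]
    refine Real.le_sqrt_of_sq_le ?_
    rw [← mul_div_assoc, le_div_iff₀ (by positivity)]
    have := hD.tau_cond
    linarith
  have hσq : ∀ t, 0 ≤ t → postStd (stationary P.k) P.σon D.X (P.xref t) ≤ q := by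
    intro t ht
    rw [hq]
    refine Real.sqrt_le_sqrt ?_
    rw [le_div_iff₀ (by positivity)]
    rcases le_or_gt (postVar (stationary P.k) P.σon D.X (P.xref t)) 0 with hv | hv
    · nlinarith [mul_pos hk0 hρ]
    · have h1 := hk.dataDensity_mul_le hσ hk0 hdiag D.X (P.xref t)
      have h2 : ρ ≤ dataDensity (stationary P.k) P.σon D.X (P.xref t) :=
        minDataDensity_le _ _ _ _ ht
      have h3 := mul_le_mul_of_nonneg_right h2 (mul_pos hk0 hv).le
      linarith
  set S := sSup ((fun t => eta P.k P.σon P.𝕏 P.δ P.Lf D.Lμ D.τ D.X (P.xref t)) '' Ici 0) with hS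
  have hS0 : 0 ≤ S := Real.sSup_nonneg (by
    rintro _ ⟨t, -, rfl⟩
    exact eta_nonneg hD.tau_pos.le)
  have hSle : S ≤ 2 * √β * q := by
    refine csSup_le (nonempty_Ici.image _) ?_
    rintro _ ⟨t, ht, rfl⟩
    have := mul_le_mul_of_nonneg_left (hσq t ht) hsβ.le
    simp only [eta, ← hβdef]
    linarith
  -- `κ` absorbs `ζ` and the rate; the remaining `√β` cancels against the bound on `S`.
  have hυ : P.upsilonBar D = κ * (S / (2 * √β)) := by
    have hr := hD.rate_ne_zero
    rw [upsilonBar, ← hS, hD.kappa_eq, ← hβdef]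
    field_simp
  have hqe : q = √(2 / P.k 0) * (1 / √ρ) := by
    rw [hq, ← div_div, Real.sqrt_div (by positivity)]
    ring
  rw [hυ, abs_mul, abs_of_nonneg (div_nonneg hS0 (by positivity)), mul_assoc, ← hqe]
  refine mul_le_mul_of_nonneg_left ?_ (abs_nonneg κ)
  rw [div_le_iff₀ (by positivity)]
  linarith

end Problem

end GPTracking

/-! ### Assembly of the asymptotic and tracking bounds -/

theorem mainTheorem2 {d : ℕ} (P : Problem d) (Lk : ℝ≥0) (Θ : Set (State d)) (α : ℝ → ℝ)
    (rref : ℝ → ℝ) (κ : ℝ)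
    -- the domain, the confidence level and the noise level
    (h𝕏 : IsCompact P.𝕏) (hδ : P.δ ∈ Set.Ioo (0 : ℝ) 1) (hσ : 0 < P.σon)
    -- the stationary Lipschitz kernel, with a finite constant `L_σ`
    (hk : IsKernel (stationary P.k)) (hk_diff : Differentiable ℝ P.k)
    (hk_lip : LipschitzOnWith Lk P.k {r | ∃ x ∈ P.𝕏, ∃ x' ∈ P.𝕏, r = x - x'})
    (hLσ : BddAbove (kernelSlopes P.k P.𝕏))
    -- the stability assumption and the reference trajectory
    (hstab : StabilizedBy P.A P.b Θ α) (href : IsReference P.A P.b P.𝕏 P.xref rref) :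
    -- `ῡ ∈ O(1 / √ρ̲)` as `ρ̲ → ∞`, over all admissible choices with the constant value `κ`
    ((fun D : Design d => P.upsilonBar D)
      =O[Filter.comap P.rhoMin Filter.atTop ⊓ Filter.principal {D | P.Admissible D Θ α κ}]
        fun D => 1 / √(P.rhoMin D)) ∧
    -- for convex `𝕏`, `ῡ` bounds the tracking error from zero initial error with probability `1 - δ`
    (Convex ℝ P.𝕏 → ∀ D : Design d, P.Admissible D Θ α κ →
      ∀ {Ω : Type*} [MeasurableSpace Ω] (Pr : Measure Ω) [IsProbabilityMeasure Pr]
        (f : State d → Ω → ℝ) (ε : Fin D.N → Ω → ℝ),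
        IsSamplingModel Pr (stationary P.k) P.σon P.𝕏 f ε →
        ∃ G : Set Ω, MeasurableSet G ∧ 1 - P.δ ≤ Pr.real G ∧ ∀ ω ∈ G,
          let μ : State d → ℝ :=
            postMean (stationary P.k) P.σon D.X (fun j => f (D.X j) ω + ε j ω)
          LipschitzOnWith P.Lf (fun x => f x ω) P.𝕏 → LipschitzOnWith D.Lμ μ P.𝕏 →
          ∀ x : ℝ → State d,
            IsClosedLoop P.A P.b P.𝕏 (fun x => f x ω) μ D.θ P.xref rref x →
            x 0 = P.xref 0 →
            ∀ t, 0 ≤ t → ‖x t - P.xref t‖ ≤ P.upsilonBar D) := by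
  have hxref : ∀ t, 0 ≤ t → P.xref t ∈ P.𝕏 := fun t ht => (href t ht).1
  refine ⟨Asymptotics.IsBigO.of_bound (|κ| * √(2 / P.k 0)) ?_, ?_⟩
  · rw [eventually_inf_principal]
    filter_upwards [tendsto_comap.eventually (eventually_gt_atTop (0 : ℝ))] with D hρ hD
    rw [Real.norm_eq_abs, Real.norm_eq_abs, abs_of_nonneg (by positivity : 0 ≤ 1 / √(P.rhoMin D))]
    exact Problem.abs_upsilonBar_le h𝕏 hδ hσ hk hxref hD hρ
  · intro hconv D hD Ω _ Pr _ f ε hM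
    obtain ⟨G, hG, hPG, hGb⟩ := hM.exists_event_abs_sub_le_eta hk hσ hconv h𝕏
      ⟨_, hxref 0 le_rfl⟩ hk_diff hLσ hD.inputs_mem hδ hD.tau_pos P.Lf D.Lμ
    refine ⟨G, hG, hPG, fun ω hω => ?_⟩
    intro μ hLf hLμ x hx hx0 t ht
    have herr := hGb ω hω hLf hLμ
    have hbdd := bddAbove_eta hk hσ P.𝕏 P.δ D.τ P.Lf D.Lμ D.X P.xref
    set S := sSup ((fun t => eta P.k P.σon P.𝕏 P.δ P.Lf D.Lμ D.τ D.X (P.xref t)) '' Ici 0) with hS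
    have hS0 : 0 ≤ S := Real.sSup_nonneg (by
      rintro _ ⟨t, -, rfl⟩
      exact eta_nonneg hD.tau_pos.le)
    have hrate : P.rate D = lamMax (closedLoopMatrix P.A P.b D.θ) +
        zeta P.b D.U * (lipStd P.k P.𝕏 * √(beta P.𝕏 P.δ D.τ)) := by
      rw [Problem.rate]; ring
    have key := norm_le_of_linear_system_of_growth hD.eigen hS0
      (mul_nonneg (lipStd_nonneg P.k P.𝕏) (Real.sqrt_nonneg (beta P.𝕏 P.δ D.τ)))
      (hrate ▸ Problem.rate_neg hstab hD) (fun t ht => error_hasDerivWithinAt href hx ht)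
      (by rw [hx0, sub_self]) (fun s hs => ?_) ht
    · refine key.trans_eq ?_
      rw [← hrate, Problem.upsilonBar, ← hS, div_neg]
      ring
    -- Lipschitz continuity of `σ` moves `η` from `x s` to the reference, at the cost `√β L_σ ‖x s -
    -- x_ref s‖`.
    · refine (herr (x s) (hx s hs).1).trans ?_
      have h1 := hM.postStd_le_add_lipStd hk hσ hconv hk_diff hLσ hD.inputs_mem (hxref s hs)
        (hx s hs).1
      have h2 := mul_le_mul_of_nonneg_left h1 (Real.sqrt_nonneg (beta P.𝕏 P.δ D.τ))
      have h3 : eta P.k P.σon P.𝕏 P.δ P.Lf D.Lμ D.τ D.X (P.xref s) ≤ S :=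
        le_csSup hbdd ⟨s, hs, rfl⟩
      unfold eta at h3 ⊢
      linarith
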